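/- **Theorem 2.9.** Let $\Omega$ be a finite set, $n\in\mathbb N$, and let $H:\Omega\to\{0,\dots,n\}$ be a Hamiltonian with $H(x)=0$ for at least one $x\in\Omega$. Write $q=\ln|\Omega|$, and assume $\ln n\ge 1$, $\ln q\ge 1$ and $|\Omega|\ge\ln n$. For $\beta\ge 0$ let $Z(\beta)=\sum_{x\in\Omega}e^{-\beta H(x)}$ be the partition function and $\mu_\beta(x)=e^{-\beta H(x)}/Z(\beta)$ the Gibbs distribution. Let $0\le\beta_{\min}<\beta_{\max}$ and $0<\delta\le 1/2$. There is a single classical procedure (a program with exact real arithmetic) which is given only $n$, $|\Omega|$, $\beta_{\min}$, $\beta_{\max}$, $\delta$ as input, and which has access to $H$ only by adaptively requesting independent samples $x\sim\mu_\beta$, at inverse temperatures $\beta\ge 0$ of its choice, and reading off $H(x)$, such that, for all $\Omega,n,H,\beta_{\min},\beta_{\max},\delta$ as above: 1. with probability at least $1-\delta$ it outputs a cooling schedule $\beta_{\min}=\beta_0<\beta_1<\dots<\beta_\ell=\beta_{\max}$ that is $2\cdot10^5$-slowly varying, i.e. $$\frac{Z(\beta_i)\,Z(\beta_{i+1})}{Z\big(\tfrac{\beta_i+\beta_{i+1}}2\big)^2}\le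 2\cdot 10^5\qquad\text{for all }0\le i<\ell,$$ and whose length satisfies $\ell\le 11\sqrt q\,\ln n$; 2. it always uses at most $5\cdot10^4\; q\,\ln^2 n\,(\ln q+\ln n)^2\,\ln(1/\delta)$ samples. -/

import Mathlib

open scoped NNReal ENNReal

noncomputable section

namespace Gibbs

/-! ## Partition function and Gibbs distribution -/

section Distribution

variable {Ω : Type*} [Fintype Ω]

/-- The partition function `Z(β) = ∑ₓ exp(-β H(x))`. -/
def partitionFunction (H : Ω → ℕ) (β : ℝ) : ℝ :=
  ∑ x, Real.exp (-β * H x)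

theorem partitionFunction_pos [Nonempty Ω] (H : Ω → ℕ) (β : ℝ) : 0 < partitionFunction H β :=
  Finset.sum_pos (fun _ _ => Real.exp_pos _) Finset.univ_nonempty

/-- The Gibbs distribution `μ_β(x) = exp(-β H(x)) / Z(β)`. -/
def gibbs [Nonempty Ω] (H : Ω → ℕ) (β : ℝ) : PMF Ω :=
  PMF.ofFintype (fun x => ENNReal.ofReal (Real.exp (-β * H x) / partitionFunction H β)) (by
    have hZ := partitionFunction_pos H β
    rw [← ENNReal.ofReal_sum_of_nonneg (fun x _ => div_nonneg (Real.exp_pos _).le hZ.le),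
      ← Finset.sum_div]
    change ENNReal.ofReal (partitionFunction H β / partitionFunction H β) = 1
    rw [div_self hZ.ne', ENNReal.ofReal_one])

end Distribution

/-! ## Cooling schedules -/

/-- A cooling schedule `a = β₀ < β₁ < ⋯ < β_ℓ = b`, given as the list `[β₀, …, β_ℓ]`. -/
structure IsCoolingSchedule (a b : ℝ) (s : List ℝ) : Prop where
  head : s.head? = some a
  last : s.getLast? = some b
  increasing : s.Pairwise (· < ·)

/-- A schedule is `c`-slowly varying if `Z(βᵢ) Z(βᵢ₊₁) / Z((βᵢ + βᵢ₊₁)/2)² ≤ c` for any two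
consecutive inverse temperatures. -/
def IsSlowlyVarying {Ω : Type*} [Fintype Ω] (H : Ω → ℕ) (c : ℝ) (s : List ℝ) : Prop :=
  s.IsChain fun x y =>
    partitionFunction H x * partitionFunction H y / partitionFunction H ((x + y) / 2) ^ 2 ≤ c

/-- The length `ℓ` of a schedule `β₀ < ⋯ < β_ℓ` is its number of steps. -/
def scheduleLength (s : List ℝ) : ℕ := s.length - 1

/-! ## Adaptive use of Gibbs samples

A computation with access to Gibbs samples either is finished, or asks for a fresh independent
sample `x ∼ μ_β` at an inverse temperature `β ≥ 0` of its choice and continues depending on the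
energy `H(x)` of that sample. -/

inductive SampleTree (α : Type) : Type
  | done (a : α) : SampleTree α
  | draw (β : ℝ≥0) (next : ℕ → SampleTree α) : SampleTree α

namespace SampleTree

/-- Sequential composition. -/
def bind {α β : Type} : SampleTree α → (α → SampleTree β) → SampleTree β
  | done a, f => f a
  | draw b next, f => draw b fun e => (next e).bind f

/-- Run the body `f` a given number of times, passing on the state. -/
def repeatN {α : Type} (f : α → SampleTree α) : ℕ → α → SampleTree α
  | 0, a => done a
  | k + 1, a => (f a).bind (repeatN f k)

variable {Ω : Type*} [Fintype Ω]

/-- The distribution of the output, when every request at `β` is answered by the energy of an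
independent sample from `μ_β`. -/
def outputLaw [Nonempty Ω] (H : Ω → ℕ) {α : Type} : SampleTree α → PMF α
  | done a => PMF.pure a
  | draw β next => (gibbs H β).bind fun x => (next (H x)).outputLaw H

/-- The number of samples used in the worst case, over all outcomes of the samples. -/
def numSamples (H : Ω → ℕ) {α : Type} : SampleTree α → ℕ
  | done _ => 0
  | draw _ next => 1 + Finset.univ.sup fun x : Ω => (next (H x)).numSamples H

end SampleTree

/-! ## Procedures

A classical procedure is a finite program over exact real numbers, finite lists of real numbers
and tuples of these. It has rational constants, arithmetic, `exp`, `log`, `⌊·⌋`, array access,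
comparisons, branching, counted loops, and an instruction that draws a Gibbs sample. It has no
access to the Hamiltonian other than through that instruction. -/

inductive Program : Type → Type → Type 1
  /-- identity, sequential composition, and handling of tuples -/
  | id {α : Type} : Program α α
  | comp {α β γ : Type} (p : Program α β) (r : Program β γ) : Program α γ
  | pair {α β γ : Type} (p : Program α β) (r : Program α γ) : Program α (β × γ)
  | fst {α β : Type} : Program (α × β) α
  | snd {α β : Type} : Program (α × β) β
  /-- real arithmetic -/
  | const {α : Type} (c : ℚ) : Program α ℝ
  | add : Program (ℝ × ℝ) ℝ
  | sub : Program (ℝ × ℝ) ℝ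
  | mul : Program (ℝ × ℝ) ℝ
  | div : Program (ℝ × ℝ) ℝ
  | exp : Program ℝ ℝ
  | log : Program ℝ ℝ
  | floor : Program ℝ ℝ
  /-- lists: the empty list, appending an entry, reading and overwriting the entry at an index -/
  | nil {α : Type} : Program α (List ℝ)
  | push : Program (List ℝ × ℝ) (List ℝ)
  | get : Program (List ℝ × ℝ) ℝ
  | set : Program (List ℝ × ℝ × ℝ) (List ℝ)
  /-- `ifLE t p r` runs `p` if the first component of the result of `t` is at most the second
  one, and runs `r` otherwise -/
  | ifLE {α β : Type} (t : Program α (ℝ × ℝ)) (p r : Program α β) : Program α β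
  /-- `loop t p` runs the body `p` as many times as the value of `t` (rounded down) says -/
  | loop {α : Type} (t : Program α ℝ) (p : Program α α) : Program α α
  /-- draw a Gibbs sample at the given inverse temperature and return its energy -/
  | sample : Program ℝ ℝ

namespace Program

open SampleTree in
/-- The meaning of a program: from its input, an adaptive computation with Gibbs samples. -/
def run : {α β : Type} → Program α β → α → SampleTree β
  | _, _, id, a => done a
  | _, _, comp p r, a => (p.run a).bind r.run
  | _, _, pair p r, a => (p.run a).bind fun b => (r.run a).bind fun c => done (b, c)
  | _, _, fst, a => done a.1
  | _, _, snd, a => done a.2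
  | _, _, const c, _ => done (c : ℝ)
  | _, _, add, a => done (a.1 + a.2)
  | _, _, sub, a => done (a.1 - a.2)
  | _, _, mul, a => done (a.1 * a.2)
  | _, _, div, a => done (a.1 / a.2)
  | _, _, exp, a => done (Real.exp a)
  | _, _, log, a => done (Real.log a)
  | _, _, floor, a => done (⌊a⌋ : ℝ)
  | _, _, nil, _ => done []
  | _, _, push, a => done (a.1 ++ [a.2])
  | _, _, get, a => done (a.1.getD ⌊a.2⌋₊ 0)
  | _, _, set, a => done (a.1.set ⌊a.2.1⌋₊ a.2.2)
  | _, _, ifLE t p r, a => (t.run a).bind fun c => if c.1 ≤ c.2 then p.run a else r.run a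
  | _, _, loop t p, a => (t.run a).bind fun c => repeatN p.run ⌊c⌋₊ a
  | _, _, sample, b => draw b.toNNReal fun e => done (e : ℝ)

end Program

end Gibbs

end

open scoped NNReal ENNReal

noncomputable section

namespace Gibbs

/-! ## Overlap of two Gibbs distributions -/

section Overlap

variable {Ω : Type*} [Fintype Ω]

/-! Steps are judged by the overlap `P(H(X) ≤ H(Y))` of independent `X ∼ μ_x`, `Y ∼ μ_y`, which can
be tested by sampling although `Z` is unknown. Overlap at least `1/c` makes the step from `x` to `y`
`c`-slowly varying (`ratio_le_of_le_overlap`). Overlap at most `1/16` makes it long: its ratio is at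
least `2` (`two_mul_sq_le_of_overlap_le`). So it suffices to find steps whose overlap lies in a
window between two constants; a noisy bisection does this (`failProb_scoreTree`,
`failProb_bisectTree`).

Long steps are few. As `log Z` is convex with slope `-meanEnergy`, a ratio of at least `2` forces
the mean energy to fall: either it halves, or the drop of `log Z` and the relative drop of the
energy have product bounded below. The quantity `potential` adds `log Z`, which lies in `[0, q]` for
`β ≥ 0`, with weight `1/√q`, and the logarithm of the energy, truncated from below, with weight
`√q`. It loses at least `1` on every long step (`potential_step`), while its total range is at most
`√q (2.4 + ln n)`.

Bisection is used only up to `C = min(q, β_max)`: from `q = ln |Ω|` on, `Z` is constant up to a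
factor `2`, so a single further step suffices (`ratio_le_two`). A union bound over all tests gives
the success probability (`failProb_scheduleTree`). The adaptive computation is analysed as a
`SampleTree`, and `run_coolingProcedure` identifies the program with it. -/

/-- The probability of `x` under the Gibbs distribution, as a real number. -/
def gibbsWeight (H : Ω → ℕ) (β : ℝ) (x : Ω) : ℝ :=
  Real.exp (-β * H x) / partitionFunction H β

/-- The mean energy `E_β[H]`. -/
def meanEnergy (H : Ω → ℕ) (β : ℝ) : ℝ :=
  ∑ x, gibbsWeight H β x * H x

/-- The probability that `H(Y) ≥ H(X)` for independent `X ∼ μ_β` and `Y ∼ μ_γ`. -/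
def overlap (H : Ω → ℕ) (β γ : ℝ) : ℝ :=
  ∑ u, ∑ v, gibbsWeight H β u * gibbsWeight H γ v * if H u ≤ H v then 1 else 0

variable (H : Ω → ℕ)

theorem partitionFunction_antitone : Antitone (partitionFunction H) := by
  intro a b hab
  refine Finset.sum_le_sum fun x _ => Real.exp_le_exp.2 ?_
  nlinarith [Nat.cast_nonneg (α := ℝ) (H x)]

theorem partitionFunction_sq (m : ℝ) :
    partitionFunction H m ^ 2 = ∑ u, ∑ v, Real.exp (-m * H u) * Real.exp (-m * H v) := by
  rw [sq, partitionFunction, Finset.sum_mul_sum]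

theorem one_le_partitionFunction (h0 : ∃ x, H x = 0) (β : ℝ) : 1 ≤ partitionFunction H β := by
  obtain ⟨x, hx⟩ := h0
  calc (1 : ℝ) = Real.exp (-β * H x) := by simp [hx]
    _ ≤ _ := Finset.single_le_sum (f := fun x => Real.exp (-β * H x))
        (fun _ _ => (Real.exp_pos _).le) (Finset.mem_univ x)

theorem partitionFunction_le_card {β : ℝ} (hβ : 0 ≤ β) :
    partitionFunction H β ≤ Fintype.card Ω := by
  calc partitionFunction H β ≤ ∑ _x : Ω, (1 : ℝ) := by
        refine Finset.sum_le_sum fun x _ => Real.exp_le_one_iff.2 ?_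
        nlinarith [Nat.cast_nonneg (α := ℝ) (H x)]
    _ = _ := by simp

variable [Nonempty Ω]

theorem gibbsWeight_pos (β : ℝ) (x : Ω) : 0 < gibbsWeight H β x :=
  div_pos (Real.exp_pos _) (partitionFunction_pos H β)

theorem sum_gibbsWeight (β : ℝ) : ∑ x, gibbsWeight H β x = 1 := by
  unfold gibbsWeight
  rw [← Finset.sum_div]
  exact div_self (partitionFunction_pos H β).ne'

theorem overlap_nonneg (β γ : ℝ) : 0 ≤ overlap H β γ :=
  Finset.sum_nonneg fun u _ => Finset.sum_nonneg fun v _ =>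
    mul_nonneg (mul_pos (gibbsWeight_pos H β u) (gibbsWeight_pos H γ v)).le
      (by split_ifs <;> norm_num)

theorem overlap_mul (β γ : ℝ) :
    overlap H β γ * (partitionFunction H β * partitionFunction H γ) =
      ∑ u, ∑ v, Real.exp (-β * H u) * Real.exp (-γ * H v) * if H u ≤ H v then 1 else 0 := by
  have h1 := (partitionFunction_pos H β).ne'
  have h2 := (partitionFunction_pos H γ).ne'
  unfold overlap gibbsWeight
  simp only [Finset.sum_mul]
  refine Finset.sum_congr rfl fun u _ => Finset.sum_congr rfl fun v _ => ?_
  field_simp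

/-- By symmetry the events `H u ≤ H v` and `H v ≤ H u` are equally likely, and together they cover
everything. This starts the bisection at its left end. -/
theorem half_le_overlap_self (β : ℝ) : 1 / 2 ≤ overlap H β β := by
  have h1 : ∑ u, ∑ v, gibbsWeight H β u * gibbsWeight H β v = 1 := by
    rw [← Finset.sum_mul_sum, sum_gibbsWeight, one_mul]
  have h2 : overlap H β β =
      ∑ u, ∑ v, gibbsWeight H β u * gibbsWeight H β v * if H v ≤ H u then 1 else 0 := by
    unfold overlap
    rw [Finset.sum_comm]
    simp only [mul_comm]
  have h3 : 1 ≤ overlap H β β + overlap H β β := by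
    nth_rewrite 2 [h2]
    rw [overlap, ← Finset.sum_add_distrib, ← h1]
    refine Finset.sum_le_sum fun u _ => ?_
    rw [← Finset.sum_add_distrib]
    refine Finset.sum_le_sum fun v _ => ?_
    have := mul_pos (gibbsWeight_pos H β u) (gibbsWeight_pos H β v)
    rcases le_total (H u) (H v) with h | h <;> simp only [h, if_true] <;> split_ifs <;> nlinarith
  linarith

/-- Over an interval of length at most `1/n` each Boltzmann factor shrinks by at most `e`, and `Z`
does not grow. This carries the lower bound from the left end of a short bisection interval to its
right end. -/
theorem overlap_ge_exp_neg_one_mul {n : ℕ} (hn : ∀ x, H x ≤ n) (β : ℝ) {γ γ' : ℝ} (h : γ ≤ γ')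
    (h' : (γ' - γ) * n ≤ 1) : Real.exp (-1) * overlap H β γ ≤ overlap H β γ' := by
  unfold overlap
  simp only [Finset.mul_sum]
  refine Finset.sum_le_sum fun u _ => Finset.sum_le_sum fun v _ => ?_
  have hw : Real.exp (-1) * gibbsWeight H γ v ≤ gibbsWeight H γ' v := by
    unfold gibbsWeight
    rw [← mul_div_assoc, ← Real.exp_add]
    refine div_le_div₀ (Real.exp_pos _).le (Real.exp_le_exp.2 ?_) (partitionFunction_pos H γ')
      (partitionFunction_antitone H h)
    have : (H v : ℝ) ≤ n := by exact_mod_cast hn v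
    nlinarith
  have h1 := (gibbsWeight_pos H β u).le
  calc _ = gibbsWeight H β u * (Real.exp (-1) * gibbsWeight H γ v) *
        (if H u ≤ H v then 1 else 0) := by ring
    _ ≤ _ := mul_le_mul_of_nonneg_right (mul_le_mul_of_nonneg_left hw h1)
        (by split_ifs <;> norm_num)

/-- Where `H u ≤ H v`, replacing both `x` and `y` by their midpoint lowers the exponent `x H(u) + y
H(v)` by `(y - x)(H(v) - H(u))/2 ≥ 0`. -/
theorem overlap_mul_le {x y : ℝ} (h : x ≤ y) :
    overlap H x y * (partitionFunction H x * partitionFunction H y) ≤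
      partitionFunction H ((x + y) / 2) ^ 2 := by
  rw [overlap_mul, partitionFunction_sq]
  refine Finset.sum_le_sum fun u _ => Finset.sum_le_sum fun v _ => ?_
  rw [← Real.exp_add, ← Real.exp_add]
  split_ifs with huv
  · rw [mul_one]
    have : (H u : ℝ) ≤ H v := by exact_mod_cast huv
    exact Real.exp_le_exp.2 (by nlinarith)
  · simpa using (Real.exp_pos _).le

theorem ratio_le_of_le_overlap {x y c : ℝ} (h : x ≤ y) (hc : 0 < c) (hp : 1 ≤ c * overlap H x y) :
    partitionFunction H x * partitionFunction H y / partitionFunction H ((x + y) / 2) ^ 2 ≤ c := by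
  have h1 := overlap_mul_le H h
  have h2 := mul_pos (partitionFunction_pos H x) (partitionFunction_pos H y)
  rw [div_le_iff₀ (pow_pos (partitionFunction_pos H _) 2)]
  nlinarith [mul_le_mul_of_nonneg_left h1 hc.le]

/-- If the overlap is small, then a step of the schedule has a definite second difference. -/
theorem two_mul_sq_le_of_overlap_le {x y : ℝ} (hp : overlap H x y ≤ 1 / 16) :
    2 * partitionFunction H ((x + y) / 2) ^ 2 ≤ partitionFunction H x * partitionFunction H y := by
  set m := (x + y) / 2 with hm
  set W : ℝ := partitionFunction H x * partitionFunction H y with hW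
  have hWpos : 0 < W := mul_pos (partitionFunction_pos H x) (partitionFunction_pos H y)
  let w : Ω → Ω → ℝ := fun u v => Real.exp (-x * H u) * Real.exp (-y * H v)
  let χ : Ω → Ω → ℝ := fun u v => if H u ≤ H v then 1 else 0
  have hwpos : ∀ u v, 0 < w u v := fun u v => mul_pos (Real.exp_pos _) (Real.exp_pos _)
  have hsum : ∑ u, ∑ v, w u v = W := by
    rw [hW, partitionFunction, partitionFunction, Finset.sum_mul_sum]
  have hE : ∑ u, ∑ v, w u v * χ u v = overlap H x y * W := (overlap_mul H x y).symm
  -- The left side is the geometric mean of `w u v` and `w v u`. The uneven weights `2` and `1/8`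
  -- put the small coefficient on the term whose total is only bounded by `W`; the other is summed
  -- over `H u ≤ H v`, where the overlap bound applies: `2/16 + 1/8 = 1/4`.
  have hamgm : ∀ u v, Real.exp (-m * H u) * Real.exp (-m * H v) ≤ 2 * w u v + w v u / 8 := by
    intro u v
    have h2 : (Real.exp (-m * H u) * Real.exp (-m * H v)) ^ 2 = w u v * w v u := by
      simp only [w, ← Real.exp_add, ← Real.exp_nat_mul]
      congr 1
      rw [hm]; push_cast; ring
    have h3 : 0 ≤ 2 * w u v + w v u / 8 := by linarith [hwpos u v, hwpos v u]
    refine abs_le_of_sq_le_sq' ?_ h3 |>.2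
    rw [h2]
    nlinarith [sq_nonneg (2 * w u v - w v u / 8)]
  have hχ : ∀ u v, 0 ≤ χ u v ∧ χ u v ≤ 1 ∧ 1 ≤ χ u v + χ v u := by
    intro u v
    simp only [χ]
    rcases le_total (H u) (H v) with h | h <;> simp only [h, if_true] <;> split_ifs <;> norm_num
  have hhalf : ∑ u, ∑ v, Real.exp (-m * H u) * Real.exp (-m * H v) * χ u v ≤ W / 4 := by
    calc _ ≤ ∑ u, ∑ v, (2 * (w u v * χ u v) + w v u / 8) := by
          refine Finset.sum_le_sum fun u _ => Finset.sum_le_sum fun v _ => ?_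
          nlinarith [hamgm u v, hχ u v, hwpos v u]
      _ = 2 * (overlap H x y * W) + W / 8 := by
          simp only [Finset.sum_add_distrib, ← Finset.mul_sum, ← Finset.sum_div]
          rw [hE, Finset.sum_comm, hsum]
      _ ≤ W / 4 := by nlinarith
  have hswap : ∑ u, ∑ v, Real.exp (-m * H u) * Real.exp (-m * H v) * χ v u ≤ W / 4 := by
    rw [Finset.sum_comm]
    refine le_trans (le_of_eq ?_) hhalf
    exact Finset.sum_congr rfl fun u _ => Finset.sum_congr rfl fun v _ => by ring
  have : partitionFunction H m ^ 2 ≤ W / 4 + W / 4 := by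
    refine le_trans ?_ (add_le_add hhalf hswap)
    rw [partitionFunction_sq, ← Finset.sum_add_distrib]
    refine Finset.sum_le_sum fun u _ => ?_
    rw [← Finset.sum_add_distrib]
    refine Finset.sum_le_sum fun v _ => ?_
    have := mul_pos (Real.exp_pos (-m * H u)) (Real.exp_pos (-m * H v))
    nlinarith [hχ u v]
  linarith

/-! ### Convexity of `log Z` and the mean energy. -/

/-- Jensen's inequality for `Z(b)/Z(a) = E_a[exp(-(b-a)H)]`, proved by `1 + t ≤ exp t` around the
mean. -/
theorem partitionFunction_tangent (a b : ℝ) :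
    partitionFunction H a * Real.exp (-(b - a) * meanEnergy H a) ≤ partitionFunction H b := by
  have hZ := partitionFunction_pos H a
  set g := meanEnergy H a with hg
  have hgZ : ∑ x, Real.exp (-a * H x) * H x = g * partitionFunction H a := by
    rw [hg, meanEnergy, Finset.sum_mul]
    refine Finset.sum_congr rfl fun x _ => ?_
    unfold gibbsWeight
    field_simp
  calc _ = Real.exp (-(b - a) * g) * ∑ x, (Real.exp (-a * H x) * (1 + (b - a) * g)
        - (b - a) * (Real.exp (-a * H x) * H x)) := by
        rw [Finset.sum_sub_distrib, ← Finset.mul_sum, hgZ, ← Finset.sum_mul]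
        change _ = _ * (partitionFunction H a * _ - _)
        ring
    _ ≤ _ := by
        rw [Finset.mul_sum]
        refine Finset.sum_le_sum fun x _ => ?_
        have h1 : Real.exp (-b * H x) = Real.exp (-(b - a) * g) *
            (Real.exp (-a * H x) * Real.exp (-(b - a) * (H x - g))) := by
          rw [← Real.exp_add, ← Real.exp_add]; congr 1; ring
        rw [h1]
        refine mul_le_mul_of_nonneg_left ?_ (Real.exp_pos _).le
        have h2 := Real.add_one_le_exp (-(b - a) * (H x - g))
        have h3 := mul_le_mul_of_nonneg_left h2 (Real.exp_pos (-a * H x)).le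
        linarith

/-- The tangent inequality for the convex function `log Z`. -/
theorem log_partitionFunction_tangent (a b : ℝ) :
    Real.log (partitionFunction H a) - (b - a) * meanEnergy H a ≤
      Real.log (partitionFunction H b) := by
  have h := Real.log_le_log (mul_pos (partitionFunction_pos H a) (Real.exp_pos _))
    (partitionFunction_tangent H a b)
  rw [Real.log_mul (partitionFunction_pos H a).ne' (Real.exp_pos _).ne', Real.log_exp] at h
  linarith

theorem meanEnergy_nonneg (β : ℝ) : 0 ≤ meanEnergy H β :=
  Finset.sum_nonneg fun x _ => mul_nonneg (gibbsWeight_pos H β x).le (Nat.cast_nonneg _)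

theorem meanEnergy_le {n : ℕ} (hn : ∀ x, H x ≤ n) (β : ℝ) : meanEnergy H β ≤ n := by
  calc meanEnergy H β ≤ ∑ x, gibbsWeight H β x * n := by
        refine Finset.sum_le_sum fun x _ =>
          mul_le_mul_of_nonneg_left ?_ (gibbsWeight_pos H β x).le
        exact_mod_cast hn x
    _ = n := by rw [← Finset.sum_mul, sum_gibbsWeight, one_mul]

/-- The comparison fails only if `H(X) ≥ 1`, so Markov's inequality applies. Hence a long step never
starts at small mean energy. -/
theorem one_sub_overlap_le_meanEnergy (β γ : ℝ) : 1 - overlap H β γ ≤ meanEnergy H β := by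
  have h1 : ∑ u, gibbsWeight H β u * (if H u = 0 then 1 else 0) ≤ overlap H β γ := by
    refine Finset.sum_le_sum fun u _ => ?_
    split_ifs with hu
    · simp only [hu, Nat.zero_le, if_true, mul_one]
      rw [← Finset.mul_sum, sum_gibbsWeight, mul_one]
    · rw [mul_zero]
      exact Finset.sum_nonneg fun v _ =>
        mul_nonneg (mul_pos (gibbsWeight_pos H β u) (gibbsWeight_pos H γ v)).le
          (by split_ifs <;> norm_num)
  have h2 : 1 ≤ meanEnergy H β + ∑ u, gibbsWeight H β u * (if H u = 0 then 1 else 0) := by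
    refine (sum_gibbsWeight H β).symm.le.trans ?_
    rw [meanEnergy, ← Finset.sum_add_distrib]
    refine Finset.sum_le_sum fun u _ => ?_
    have := gibbsWeight_pos H β u
    split_ifs with hu
    · simp [hu]
    · have : (1 : ℝ) ≤ H u := by exact_mod_cast Nat.one_le_iff_ne_zero.2 hu
      nlinarith
  linarith

/-- Beyond `β = log |Ω|` the partition function is constant up to a factor `2`. -/
theorem ratio_le_two (h0 : ∃ x, H x = 0) {x y : ℝ} (hx : Real.log (Fintype.card Ω) ≤ x)
    (hxy : x ≤ y) :
    partitionFunction H x * partitionFunction H y / partitionFunction H ((x + y) / 2) ^ 2 ≤ 2 := by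
  have hcard : (0 : ℝ) < Fintype.card Ω := by exact_mod_cast Fintype.card_pos
  have hx0 : 0 ≤ x := le_trans (Real.log_nonneg (by exact_mod_cast Fintype.card_pos)) hx
  -- The number of ground states: the remaining states add at most `|Ω| e^{-x} ≤ 1 ≤ N₀` to `Z(x)`.
  set N₀ : ℝ := ∑ u, if H u = 0 then (1 : ℝ) else 0 with hN
  have hge : ∀ β, N₀ ≤ partitionFunction H β := by
    intro β
    refine Finset.sum_le_sum fun u _ => ?_
    split_ifs with h
    · simp [h]
    · exact (Real.exp_pos _).le
  have hN1 : 1 ≤ N₀ := by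
    obtain ⟨u, hu⟩ := h0
    calc (1 : ℝ) = if H u = 0 then (1 : ℝ) else 0 := by simp [hu]
      _ ≤ _ := Finset.single_le_sum (f := fun u => if H u = 0 then (1 : ℝ) else 0)
        (fun _ _ => by positivity) (Finset.mem_univ u)
  have hle : partitionFunction H x ≤ N₀ + 1 := by
    calc partitionFunction H x ≤ ∑ u : Ω, ((if H u = 0 then (1 : ℝ) else 0) + Real.exp (-x)) := by
          refine Finset.sum_le_sum fun u _ => ?_
          split_ifs with h
          · simp [h, (Real.exp_pos _).le]
          · rw [zero_add]
            have : (1 : ℝ) ≤ H u := by exact_mod_cast Nat.one_le_iff_ne_zero.2 h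
            exact Real.exp_le_exp.2 (by nlinarith)
      _ = N₀ + Fintype.card Ω * Real.exp (-x) := by
          rw [Finset.sum_add_distrib, Finset.sum_const, Finset.card_univ, nsmul_eq_mul]
      _ ≤ N₀ + 1 := by
          have h1 : (Fintype.card Ω : ℝ) ≤ Real.exp x := (Real.log_le_iff_le_exp hcard).1 hx
          have h2 : Real.exp x * Real.exp (-x) = 1 := by rw [← Real.exp_add]; simp
          nlinarith [Real.exp_pos (-x)]
  have hm := hge ((x + y) / 2)
  have hy : partitionFunction H y ≤ partitionFunction H ((x + y) / 2) :=
    partitionFunction_antitone H (by linarith)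
  rw [div_le_iff₀ (pow_pos (partitionFunction_pos H _) 2)]
  have := partitionFunction_pos H y
  have := partitionFunction_pos H x
  calc _ ≤ (2 * partitionFunction H ((x + y) / 2)) * partitionFunction H ((x + y) / 2) :=
        mul_le_mul (by linarith) hy (by linarith) (by linarith)
    _ = _ := by ring

/-! ## A potential that bounds the number of steps -/

/-- A potential that drops along every step with small overlap. -/
def potential (H : Ω → ℕ) (q β : ℝ) : ℝ :=
  Real.log (partitionFunction H β) / √q + √q * Real.log (max (meanEnergy H β) (1 / 4))

theorem potential_step {q x y : ℝ} (hs : 1.6 ≤ √q) (hxy : x < y)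
    (hp : overlap H x y ≤ 1 / 16) : potential H q y + 1 ≤ potential H q x := by
  have hl2 := Real.log_two_gt_d9
  set gx := meanEnergy H x with hgx
  have hgx1 : 15 / 16 ≤ gx := by linarith [one_sub_overlap_le_meanEnergy H x y]
  have hQ : Real.log 2 + 2 * Real.log (partitionFunction H ((x + y) / 2)) ≤
      Real.log (partitionFunction H x) + Real.log (partitionFunction H y) := by
    have hZ := partitionFunction_pos H
    have h := Real.log_le_log (by have := hZ ((x + y) / 2); positivity)
      (two_mul_sq_le_of_overlap_le H hp)
    rw [Real.log_mul (by norm_num) (pow_ne_zero _ (hZ _).ne'), Real.log_pow,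
      Real.log_mul (hZ x).ne' (hZ y).ne'] at h
    exact_mod_cast h
  have h1 := log_partitionFunction_tangent H x ((x + y) / 2)
  have h2 := log_partitionFunction_tangent H y ((x + y) / 2)
  have h3 := log_partitionFunction_tangent H y x
  have hd : 2 * Real.log 2 ≤ (y - x) * (gx - meanEnergy H y) := by linarith
  have hgy0 := meanEnergy_nonneg H y
  set D := Real.log (partitionFunction H x) - Real.log (partitionFunction H y) with hD
  have hD1 : (y - x) * meanEnergy H y ≤ D := by linarith
  have hD0 : 0 ≤ D := le_trans (mul_nonneg (by linarith) hgy0) hD1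
  set gy := max (meanEnergy H y) (1 / 4) with hgy
  have hgypos : 0 < gy := lt_of_lt_of_le (by norm_num) (le_max_right _ _)
  have hmax : max gx (1 / 4) = gx := max_eq_left (by linarith)
  -- If the truncated energy at least halves, the second term alone exceeds `1.6 · log 2 > 1`.
  -- Otherwise the truncation at `1/4` is inactive at `y`, since `gx ≥ 15/16`; with `w = (y - x) gy`
  -- the two terms are at least `w/√q` and `0.69 √q/w`, and their sum is at least `2 √0.69 > 1`.
  have key : 1 ≤ D / √q + √q * Real.log (gx / gy) := by
    by_cases hc : 2 * gy ≤ gx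
    · have : Real.log 2 ≤ Real.log (gx / gy) :=
        Real.log_le_log (by norm_num) ((le_div_iff₀ hgypos).2 hc)
      have h0 : 0 ≤ D / √q := by positivity
      nlinarith
    · push Not at hc
      have hgyeq : gy = meanEnergy H y := by
        rw [hgy]
        refine max_eq_left ?_
        by_contra hlt
        rw [hgy, max_eq_right (by linarith)] at hc
        linarith
      rw [← hgyeq] at hd hD1
      have hlog : 1 - gy / gx ≤ Real.log (gx / gy) := by
        have := Real.one_sub_inv_le_log_of_pos (div_pos (by linarith) hgypos : 0 < gx / gy)
        rwa [inv_div] at this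
      set w := (y - x) * gy with hw
      have hwpos : 0 < w := mul_pos (by linarith) hgypos
      have hlog2 : 0.69 / w ≤ Real.log (gx / gy) := by
        refine le_trans ?_ hlog
        rw [div_le_iff₀ hwpos]
        have : (1 - gy / gx) * w = (y - x) * (gx - gy) * (gy / gx) := by
          rw [hw]; field_simp
        rw [this]
        have h5 : 1 / 2 ≤ gy / gx := by rw [div_le_div_iff₀ (by norm_num) (by linarith)]; linarith
        nlinarith
      calc (1 : ℝ) ≤ w / √q + √q * (0.69 / w) := by
            have hs0 : 0 < √q := by linarith
            have : w / √q + √q * (0.69 / w) = (w ^ 2 + 0.69 * √q ^ 2) / (√q * w) := by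
              field_simp
            rw [this, le_div_iff₀ (by positivity)]
            nlinarith [sq_nonneg (w - √q / 2)]
        _ ≤ _ := by gcongr
  rw [Real.log_div (by linarith) hgypos.ne'] at key
  unfold potential
  rw [← hgx, hmax, ← hgy]
  rw [hD, sub_div] at key
  linarith

theorem potential_le {n : ℕ} (hn : ∀ x, H x ≤ n) (hn1 : 1 ≤ n) {β : ℝ} (hβ : 0 ≤ β) :
    potential H (Real.log (Fintype.card Ω)) β ≤
      √(Real.log (Fintype.card Ω)) * (1 + Real.log n) := by
  set q := Real.log (Fintype.card Ω) with hq
  have h1 : Real.log (partitionFunction H β) ≤ q :=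
    Real.log_le_log (partitionFunction_pos H β) (partitionFunction_le_card H hβ)
  have h2 : Real.log (max (meanEnergy H β) (1 / 4)) ≤ Real.log n := by
    refine Real.log_le_log (lt_of_lt_of_le (by norm_num) (le_max_right _ _)) (max_le
      (meanEnergy_le H hn β) ?_)
    have : (1 : ℝ) ≤ n := by exact_mod_cast hn1
    linarith
  calc _ ≤ q / √q + √q * Real.log n := by unfold potential; gcongr
    _ = _ := by rw [Real.div_sqrt]; ring

end Overlap

theorem le_potential {Ω : Type*} [Fintype Ω] (H : Ω → ℕ) (h0 : ∃ x, H x = 0) (q β : ℝ) :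
    -(1.4 * √q) ≤ potential H q β := by
  have h1 : 0 ≤ Real.log (partitionFunction H β) / √q :=
    div_nonneg (Real.log_nonneg (one_le_partitionFunction H h0 β)) (Real.sqrt_nonneg _)
  have h2 : -1.4 ≤ Real.log (max (meanEnergy H β) (1 / 4)) := by
    have h3 : Real.log (1 / 4 : ℝ) ≤ Real.log (max (meanEnergy H β) (1 / 4)) :=
      Real.log_le_log (by norm_num) (le_max_right _ _)
    have h4 : Real.log (1 / 4 : ℝ) = -(2 * Real.log 2) := by
      rw [one_div, Real.log_inv, show (4 : ℝ) = 2 ^ 2 by norm_num, Real.log_pow]; norm_num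
    linarith [Real.log_two_lt_d9]
  unfold potential
  nlinarith [Real.sqrt_nonneg q]

/-! ## Expectations over the samples -/

namespace SampleTree

theorem done_bind {α β : Type} (a : α) (f : α → SampleTree β) : (done a).bind f = f a := rfl

theorem draw_bind {α β : Type} (b : ℝ≥0) (next : ℕ → SampleTree α) (f : α → SampleTree β) :
    (draw b next).bind f = draw b fun e => (next e).bind f := rfl

theorem bind_assoc {α β γ : Type} (t : SampleTree α) (f : α → SampleTree β)
    (g : β → SampleTree γ) : (t.bind f).bind g = t.bind fun a => (f a).bind g := by
  induction t with
  | done a => rfl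
  | draw b next ih => simp only [draw_bind, ih]

theorem bind_done {α : Type} (t : SampleTree α) : t.bind done = t := by
  induction t with
  | done a => rfl
  | draw b next ih => simp only [draw_bind, ih]

/-- A loop whose body leaves the first component of the state alone. -/
theorem repeatN_frame {α β : Type} (f : α → β → SampleTree β)
    (k : ℕ) (p : α) (s : β) :
    repeatN (fun a : α × β => (f a.1 a.2).bind fun s' => done (a.1, s')) k (p, s) =
      (repeatN (f p) k s).bind fun s' => done (p, s') := by
  induction k generalizing s with
  | zero => rfl
  | succ k ih => simp only [repeatN, bind_assoc, done_bind, ih]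

variable {Ω : Type*} [Fintype Ω] (H : Ω → ℕ) {α β : Type}

/-- The expectation of `φ` over the output. -/
def expect (φ : α → ℝ) : SampleTree α → ℝ
  | done a => φ a
  | draw b next => ∑ x, gibbsWeight H b x * (next (H x)).expect φ

theorem expect_bind (φ : β → ℝ) (t : SampleTree α) (f : α → SampleTree β) :
    (t.bind f).expect H φ = t.expect H fun a => (f a).expect H φ := by
  induction t with
  | done a => rfl
  | draw b next ih => simp only [draw_bind, expect, ih]

theorem expect_const_mul (c : ℝ) (φ : α → ℝ) (t : SampleTree α) :
    (t.expect H fun a => c * φ a) = c * t.expect H φ := by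
  induction t with
  | done a => rfl
  | draw b next ih =>
    simp only [expect, ih, Finset.mul_sum]
    exact Finset.sum_congr rfl fun x _ => by ring

/-- With `φ` an exponential of the running score, this yields the exact exponential moments needed
for the Chernoff bounds. -/
theorem expect_repeatN {φ : α → ℝ} {ρ : ℝ} {f : α → SampleTree α}
    (hf : ∀ a, (f a).expect H φ = ρ * φ a) (k : ℕ) (a : α) :
    (repeatN f k a).expect H φ = ρ ^ k * φ a := by
  induction k generalizing a with
  | zero => simp [repeatN, expect]
  | succ k ih => simp only [repeatN, expect_bind, ih, expect_const_mul, hf]; ring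

theorem numSamples_bind_le {t : SampleTree α} {f : α → SampleTree β} {k m : ℕ}
    (ht : t.numSamples H ≤ k) (hf : ∀ a, (f a).numSamples H ≤ m) :
    (t.bind f).numSamples H ≤ k + m := by
  induction t generalizing k with
  | done a => exact (hf a).trans (Nat.le_add_left _ _)
  | draw b next ih =>
    simp only [draw_bind, numSamples] at ht ⊢
    have h1 : (Finset.univ.sup fun x : Ω => ((next (H x)).bind f).numSamples H) ≤
        (Finset.univ.sup fun x : Ω => (next (H x)).numSamples H) + m :=
      Finset.sup_le fun x _ => ih _
        (Finset.le_sup (f := fun x : Ω => (next (H x)).numSamples H) (Finset.mem_univ x))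
    omega

theorem numSamples_repeatN_le {f : α → SampleTree α} {m : ℕ} (hf : ∀ a, (f a).numSamples H ≤ m)
    (k : ℕ) (a : α) : (repeatN f k a).numSamples H ≤ k * m := by
  induction k generalizing a with
  | zero => simp [repeatN, numSamples]
  | succ k ih =>
    refine (numSamples_bind_le H (hf a) ih).trans (le_of_eq ?_)
    ring

open Classical in
/-- The probability that the output violates `P`. -/
def failProb (P : α → Prop) (t : SampleTree α) : ℝ :=
  t.expect H fun a => if P a then 0 else 1

theorem failProb_done {P : α → Prop} {a : α} (h : P a) : (done a).failProb H P = 0 := by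
  simp [failProb, expect, h]

variable [Nonempty Ω]

theorem expect_mono {φ ψ : α → ℝ} (h : ∀ a, φ a ≤ ψ a) (t : SampleTree α) :
    t.expect H φ ≤ t.expect H ψ := by
  induction t with
  | done a => exact h a
  | draw b next ih =>
    exact Finset.sum_le_sum fun x _ => mul_le_mul_of_nonneg_left (ih _) (gibbsWeight_pos H b x).le

theorem expect_add_const (c : ℝ) (φ : α → ℝ) (t : SampleTree α) :
    (t.expect H fun a => φ a + c) = t.expect H φ + c := by
  induction t with
  | done a => rfl
  | draw b next ih =>
    simp only [expect, ih, mul_add, Finset.sum_add_distrib]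
    rw [← Finset.sum_mul, sum_gibbsWeight, one_mul]

theorem failProb_mono {P Q : α → Prop} (h : ∀ a, P a → Q a) (t : SampleTree α) :
    t.failProb H Q ≤ t.failProb H P := by
  refine expect_mono H (fun a => ?_) t
  by_cases hP : P a
  · simp [hP, h a hP]
  · simp only [hP, if_false]
    split_ifs <;> norm_num

theorem failProb_le_one (P : α → Prop) (t : SampleTree α) : t.failProb H P ≤ 1 := by
  refine (expect_mono H (ψ := fun _ => 0 + 1) (fun a => ?_) t).trans ?_
  · split_ifs <;> norm_num
  · rw [expect_add_const H 1 (fun _ => 0)]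
    have := expect_const_mul H 0 (fun _ => 0) t
    simp only [zero_mul] at this
    rw [this, zero_add]

/-- The union bound: if the first stage violates `P`, the second is charged its trivial failure
bound `1`. -/
theorem failProb_bind {P : α → Prop} {Q : β → Prop} {t : SampleTree α} {f : α → SampleTree β}
    {ε ε' : ℝ} (hε' : 0 ≤ ε') (ht : t.failProb H P ≤ ε)
    (hf : ∀ a, P a → (f a).failProb H Q ≤ ε') : (t.bind f).failProb H Q ≤ ε + ε' := by
  classical
  unfold failProb at *
  rw [expect_bind]
  refine le_trans (expect_mono H (ψ := fun a => (if P a then 0 else 1) + ε') (fun a => ?_) t) ?_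
  · split_ifs with h
    · rw [zero_add]; exact hf a h
    · have := failProb_le_one H Q (f a)
      unfold failProb at this
      linarith
  · rw [expect_add_const]
    convert add_le_add_left ht ε'

/-- A union bound over the rounds of a loop, with an invariant `I j` before round `j`. -/
theorem failProb_repeatN {I : ℕ → α → Prop} {f : α → SampleTree α} {ε : ℝ} (hε : 0 ≤ ε)
    (hf : ∀ j a, I j a → (f a).failProb H (I (j + 1)) ≤ ε) (k j : ℕ) (a : α) (ha : I j a) :
    (repeatN f k a).failProb H (I (j + k)) ≤ k * ε := by
  induction k generalizing j a with
  | zero => simp [repeatN, failProb_done H ha]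
  | succ k ih =>
    have h := failProb_bind H (t := f a) (f := repeatN f k) (by positivity : 0 ≤ (k : ℝ) * ε)
      (hf j a ha) (fun b hb => ih (j + 1) b hb)
    rw [show j + 1 + k = j + (k + 1) by ring] at h
    refine h.trans (le_of_eq ?_)
    push_cast; ring

open Classical in
theorem toOuterMeasure_outputLaw (t : SampleTree α) (S : Set α) :
    (t.outputLaw H).toOuterMeasure S =
      ENNReal.ofReal (t.expect H fun a => if a ∈ S then 1 else 0) := by
  induction t with
  | done a =>
    simp only [outputLaw, expect, PMF.toOuterMeasure_pure_apply]
    split_ifs <;> simp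
  | draw b next ih =>
    simp only [outputLaw, expect, PMF.toOuterMeasure_bind_apply, tsum_fintype, ih]
    rw [ENNReal.ofReal_sum_of_nonneg]
    · refine Finset.sum_congr rfl fun x _ => ?_
      rw [ENNReal.ofReal_mul (gibbsWeight_pos H b x).le]
      rfl
    · intro x _
      refine mul_nonneg (gibbsWeight_pos H b x).le ?_
      -- Zero is written as `0 * 0` so that `expect_const_mul` evaluates its expectation.
      have h := expect_mono H (φ := fun _ => 0 * 0) (ψ := fun a => if a ∈ S then (1 : ℝ) else 0)
        (fun a => by split_ifs <;> norm_num) (next (H x))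
      rw [expect_const_mul, zero_mul] at h
      exact h

theorem le_toOuterMeasure_outputLaw {t : SampleTree α} {P : α → Prop} {δ : ℝ}
    (h : t.failProb H P ≤ δ) :
    ENNReal.ofReal (1 - δ) ≤ (t.outputLaw H).toOuterMeasure {a | P a} := by
  classical
  rw [toOuterMeasure_outputLaw]
  refine ENNReal.ofReal_le_ofReal ?_
  have h1 : (t.expect H fun a => if a ∈ {a | P a} then (1 : ℝ) else 0) =
      1 - t.failProb H P := by
    have h2 : (fun a => if a ∈ {a | P a} then (1 : ℝ) else 0) =
        fun a => (-1) * (if P a then (0 : ℝ) else 1) + 1 := by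
      funext a
      by_cases hP : P a <;> simp [hP]
    rw [h2, expect_add_const, expect_const_mul, failProb]
    ring_nf
  rw [h1]
  linarith

end SampleTree

/-! ## The sampling computation that builds the schedule -/

open SampleTree

/-- Compare the energies of one sample at `x` and one at `y`. -/
def compareTree (x y : ℝ) : SampleTree ℝ :=
  draw x.toNNReal fun a => draw y.toNNReal fun b =>
    -- With overlap `p`, the factor `8` or `39/40` has mean below `49/50` when `p < 1/2000`, and its
    -- inverse has mean below `49/50` when `p > 1/16`.
    done (Real.log (if (a : ℝ) ≤ b then 8 else 39 / 40))

/-- Add up the outcomes of `N` comparisons. -/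
def scoreTree (N : ℕ) (x y : ℝ) : SampleTree ℝ :=
  repeatN (fun w => (compareTree x y).bind fun c => done (w + c)) N 0

/-- One round of a bisection for a point `y` that has a small but not too small overlap with
`x`. -/
def bisectStep (N : ℕ) (x : ℝ) (a : ℝ × ℝ) : SampleTree (ℝ × ℝ) :=
  (scoreTree N x ((a.1 + a.2) / 2)).bind fun w =>
    done (if 0 ≤ w then ((a.1 + a.2) / 2, a.2) else (a.1, (a.1 + a.2) / 2))

/-- The bisection on the interval from `x` to `C`. -/
def bisectTree (N T : ℕ) (C x : ℝ) : SampleTree ℝ :=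
  -- The right end is returned because it is strictly beyond `x` and has small overlap unless it is
  -- `C`.
  (repeatN (bisectStep N x) T (x, C)).bind fun a => done a.2

/-- Extend a schedule that ends in `a.2` by one step, unless it has reached `C`. -/
def extendTree (N T : ℕ) (C : ℝ) (a : List ℝ × ℝ) : SampleTree (List ℝ × ℝ) :=
  if C ≤ a.2 then done a else (bisectTree N T C a.2).bind fun y => done (a.1 ++ [y], y)

/-- Build a schedule from `b` to `b'`. -/
def scheduleTree (N T K : ℕ) (C b b' : ℝ) : SampleTree (List ℝ) :=
  (repeatN (extendTree N T C) K ([b], b)).bind fun a =>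
    done (if b' ≤ a.2 then a.1 else a.1 ++ [b'])

theorem IsCoolingSchedule.concat {b x y : ℝ} {s : List ℝ} (h : IsCoolingSchedule b x s)
    (hxy : x < y) : IsCoolingSchedule b y (s ++ [y]) := by
  refine ⟨?_, by simp, ?_⟩
  · rw [List.head?_append, h.head]; rfl
  · rw [List.pairwise_append]
    refine ⟨h.increasing, List.pairwise_singleton _ _, fun z hz w hw => ?_⟩
    rw [List.mem_singleton] at hw
    rw [hw]
    refine lt_of_le_of_lt ?_ hxy
    have hs : s ≠ [] := List.ne_nil_of_mem hz
    have hl : s.getLast hs = x := by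
      have := h.last
      rw [List.getLast?_eq_getLast_of_ne_nil hs] at this
      exact Option.some.inj this
    rw [← hl]
    exact (h.increasing.imp le_of_lt).rel_getLast hz

theorem IsSlowlyVarying.concat {Ω : Type*} [Fintype Ω] {H : Ω → ℕ} {c b x y : ℝ} {s : List ℝ} (h : IsSlowlyVarying H c s)
    (hs : IsCoolingSchedule b x s)
    (hxy : partitionFunction H x * partitionFunction H y / partitionFunction H ((x + y) / 2) ^ 2
      ≤ c) : IsSlowlyVarying H c (s ++ [y]) := by
  unfold IsSlowlyVarying at *
  rw [List.isChain_append]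
  refine ⟨h, List.isChain_singleton _, fun z hz w hw => ?_⟩
  rw [hs.last] at hz
  cases hz
  cases hw
  exact hxy

/-! ### Number of samples used. -/

section Cost

variable {Ω : Type*} [Fintype Ω] (H : Ω → ℕ)

theorem numSamples_compareTree_le (x y : ℝ) : (compareTree x y).numSamples H ≤ 2 := by
  simp only [compareTree, numSamples]
  have h : (Finset.univ.sup fun _ : Ω => 1 + Finset.univ.sup fun _ : Ω => 0) ≤ 1 :=
    Finset.sup_le fun _ _ => by simp
  omega

theorem numSamples_scheduleTree_le (N T K : ℕ) (C b b' : ℝ) :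
    (scheduleTree N T K C b b').numSamples H ≤ K * (T * (N * 2)) := by
  have hscore : ∀ x y, (scoreTree N x y).numSamples H ≤ N * 2 := fun x y =>
    numSamples_repeatN_le H (fun w =>
      numSamples_bind_le H (m := 0) (numSamples_compareTree_le H x y) fun _ => le_rfl) N 0
  have hstep : ∀ x a, (bisectStep N x a).numSamples H ≤ N * 2 := fun x a =>
    numSamples_bind_le H (m := 0) (hscore _ _) fun _ => le_rfl
  have hbis : ∀ x, (bisectTree N T C x).numSamples H ≤ T * (N * 2) := fun x =>
    numSamples_bind_le H (m := 0) (numSamples_repeatN_le H (hstep x) T _) fun _ => le_rfl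
  have hext : ∀ a, (extendTree N T C a).numSamples H ≤ T * (N * 2) := by
    intro a
    unfold extendTree
    split_ifs
    · exact Nat.zero_le _
    · exact numSamples_bind_le H (m := 0) (hbis _) fun _ => le_rfl
  exact numSamples_bind_le H (m := 0) (numSamples_repeatN_le H hext K _) fun _ => le_rfl

end Cost

/-! ### Failure probabilities of the test, the bisection and the schedule. -/

variable {Ω : Type*} [Fintype Ω] [Nonempty Ω] (H : Ω → ℕ)

theorem expect_compareTree {x y : ℝ} (hx : 0 ≤ x) (hy : 0 ≤ y) (φ : ℝ → ℝ) :
    (compareTree x y).expect H φ =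
      overlap H x y * φ (Real.log 8) + (1 - overlap H x y) * φ (Real.log (39 / 40)) := by
  have h1 : 1 - overlap H x y = ∑ u, ∑ v, gibbsWeight H x u * gibbsWeight H y v *
      (1 - if H u ≤ H v then 1 else 0) := by
    simp only [mul_sub, Finset.sum_sub_distrib, mul_one]
    rw [← Finset.sum_mul_sum, sum_gibbsWeight, sum_gibbsWeight, one_mul]
    rfl
  rw [h1, overlap]
  simp only [compareTree, expect, Real.coe_toNNReal x hx, Real.coe_toNNReal y hy, Nat.cast_le,
    Finset.mul_sum, Finset.sum_mul, ← Finset.sum_add_distrib]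
  refine Finset.sum_congr rfl fun u _ => Finset.sum_congr rfl fun v _ => ?_
  split_ifs <;> ring

/-- A Chernoff bound: a wrong sign of the score `w` costs at most `E[exp w]` or `E[exp (-w)]`, a
product of `N` equal factors. For overlaps between `1/2000` and `1/16` either sign is acceptable. -/
theorem failProb_scoreTree {x y : ℝ} (hx : 0 ≤ x) (hy : 0 ≤ y) (N : ℕ) :
    (scoreTree N x y).failProb H (fun w => (0 ≤ w → 1 / 2000 ≤ overlap H x y) ∧
      (¬ 0 ≤ w → overlap H x y ≤ 1 / 16)) ≤ (49 / 50) ^ N := by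
  classical
  set p := overlap H x y with hp
  have hp0 : 0 ≤ p := overlap_nonneg H x y
  have e1 : Real.exp (Real.log 8) = 8 := Real.exp_log (by norm_num)
  have e2 : Real.exp (Real.log (39 / 40)) = 39 / 40 := Real.exp_log (by norm_num)
  have hup : (scoreTree N x y).expect H Real.exp = (8 * p + 39 / 40 * (1 - p)) ^ N := by
    rw [scoreTree, expect_repeatN H (φ := Real.exp) (ρ := 8 * p + 39 / 40 * (1 - p)),
      Real.exp_zero, mul_one]
    intro w
    rw [expect_bind, expect_compareTree H hx hy]
    simp only [expect, Real.exp_add, e1, e2]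
    ring
  have hdown : (scoreTree N x y).expect H (fun w => Real.exp (-w)) =
      (p / 8 + 40 / 39 * (1 - p)) ^ N := by
    rw [scoreTree, expect_repeatN H (φ := fun w => Real.exp (-w))
      (ρ := p / 8 + 40 / 39 * (1 - p)), neg_zero, Real.exp_zero, mul_one]
    intro w
    rw [expect_bind, expect_compareTree H hx hy]
    simp only [expect, neg_add, Real.exp_add, Real.exp_neg, e1, e2]
    ring
  unfold failProb
  rcases lt_or_ge p (1 / 2000) with h | h
  · refine (expect_mono H (ψ := Real.exp) (fun w => ?_) _).trans (hup.le.trans ?_)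
    · by_cases hw : 0 ≤ w
      · split_ifs
        · exact (Real.exp_pos _).le
        · exact Real.one_le_exp hw
      · rw [if_pos ⟨fun h' => absurd h' hw, fun _ => by linarith⟩]
        exact (Real.exp_pos _).le
    · exact pow_le_pow_left₀ (by linarith) (by linarith) N
  · rcases le_or_gt p (1 / 16) with h' | h'
    · refine (expect_mono H (ψ := fun _ => (0 : ℝ) * 0) (fun w => ?_) _).trans ?_
      · rw [if_pos ⟨fun _ => h, fun _ => h'⟩, zero_mul]
      · rw [expect_const_mul, zero_mul]
        positivity
    -- Needed so that the base of the power is nonnegative.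
    · have hp1 : p ≤ 1 := by
        have h1 : ∑ u, ∑ v, gibbsWeight H x u * gibbsWeight H y v = 1 := by
          rw [← Finset.sum_mul_sum, sum_gibbsWeight, sum_gibbsWeight, one_mul]
        rw [hp, ← h1]
        refine Finset.sum_le_sum fun u _ => Finset.sum_le_sum fun v _ => ?_
        have := mul_pos (gibbsWeight_pos H x u) (gibbsWeight_pos H y v)
        split_ifs <;> linarith
      refine (expect_mono H (ψ := fun w => Real.exp (-w)) (fun w => ?_) _).trans
        (hdown.le.trans ?_)
      · by_cases hw : 0 ≤ w
        · rw [if_pos ⟨fun _ => h, fun h' => absurd hw h'⟩]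
          exact (Real.exp_pos _).le
        · split_ifs
          · exact (Real.exp_pos _).le
          · exact Real.one_le_exp (by linarith)
      · exact pow_le_pow_left₀ (by linarith) (by linarith) N

/-- What the bisection guarantees: consecutive points overlap sufficiently, and only slightly
unless the end `C` is reached. -/
def IsGoodStep (C x y : ℝ) : Prop :=
  x < y ∧ y ≤ C ∧ 1 / 6000 ≤ overlap H x y ∧ (y = C ∨ overlap H x y ≤ 1 / 16)

/-- The left end keeps overlap at least `1/2000`, and the right end is `C` or has overlap at most
`1/16`; monotonicity of the overlap is not needed. After `T` rounds the width is at most `1/n`, so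
the right end has overlap at least `e⁻¹/2000 ≥ 1/6000`. -/
theorem failProb_bisectTree {n : ℕ} (hn : ∀ x, H x ≤ n) {C x : ℝ} (hx : 0 ≤ x) (hxC : x < C)
    (N : ℕ) {T : ℕ} (hT : C * n ≤ 2 ^ T) :
    (bisectTree N T C x).failProb H (IsGoodStep H C x) ≤ T * (49 / 50) ^ N := by
  let I : ℕ → ℝ × ℝ → Prop := fun j a => x ≤ a.1 ∧ a.2 ≤ C ∧ a.2 - a.1 = (C - x) / 2 ^ j ∧
    1 / 2000 ≤ overlap H x a.1 ∧ (a.2 = C ∨ overlap H x a.2 ≤ 1 / 16)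
  have hI0 : I 0 (x, C) :=
    ⟨le_rfl, le_rfl, by simp, le_trans (by norm_num) (half_le_overlap_self H x), Or.inl rfl⟩
  have hstep : ∀ j a, I j a → (bisectStep N x a).failProb H (I (j + 1)) ≤ (49 / 50) ^ N := by
    rintro j ⟨lo, hi⟩ ⟨h1, h2, h3, h4, h5⟩
    dsimp only at h1 h2 h3 h4 h5
    have hpos : 0 < hi - lo := by rw [h3]; exact div_pos (by linarith) (by positivity)
    have h := failProb_bind H (f := fun w =>
        done (if 0 ≤ w then ((lo + hi) / 2, hi) else (lo, (lo + hi) / 2)))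
      (Q := I (j + 1)) le_rfl (failProb_scoreTree H hx (by linarith : 0 ≤ (lo + hi) / 2) N)
      (fun w hw => (failProb_done H ?_).le)
    · rwa [add_zero] at h
    · split_ifs with hw0
      · refine ⟨?_, h2, ?_, hw.1 hw0, h5⟩
        · dsimp only; linarith
        · dsimp only; rw [pow_succ, ← div_div, ← h3]; ring
      · refine ⟨h1, ?_, ?_, h4, Or.inr (hw.2 hw0)⟩
        · dsimp only; linarith
        · dsimp only; rw [pow_succ, ← div_div, ← h3]; ring
  have hloop := failProb_repeatN H (by positivity : (0 : ℝ) ≤ (49 / 50) ^ N) hstep T 0 _ hI0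
  have h := failProb_bind H (f := fun a : ℝ × ℝ => done a.2) (Q := IsGoodStep H C x) le_rfl hloop
    (fun a ha => (failProb_done H ?_).le)
  · rwa [add_zero] at h
  · obtain ⟨h1, h2, h3, h4, h5⟩ := ha
    rw [zero_add] at h3
    have hpos : 0 < a.2 - a.1 := by rw [h3]; exact div_pos (by linarith) (by positivity)
    refine ⟨by linarith, h2, ?_, h5⟩
    have hclose : (a.2 - a.1) * n ≤ 1 := by
      rw [h3, div_mul_eq_mul_div, div_le_one (by positivity)]
      nlinarith [Nat.cast_nonneg (α := ℝ) n]
    have hge := overlap_ge_exp_neg_one_mul H hn x (by linarith : a.1 ≤ a.2) hclose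
    have he : 1 / 3 ≤ Real.exp (-1) := by
      rw [Real.exp_neg, one_div]
      exact inv_anti₀ (Real.exp_pos 1) (by linarith [Real.exp_one_lt_d9])
    nlinarith

/-- The state of the computation after `j` rounds: a good schedule from `b` to `a.2 ≤ b'`, which
has reached `C` or has used up `j` units of the potential. -/
structure IsGoodState (q C b b' : ℝ) (j : ℕ) (a : List ℝ × ℝ) : Prop where
  schedule : IsCoolingSchedule b a.2 a.1
  slow : IsSlowlyVarying H (2 * 10 ^ 5) a.1
  length : a.1.length ≤ j + 1
  ge : b ≤ a.2
  le : a.2 ≤ b'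
  progress : C ≤ a.2 ∨ potential H q a.2 + j ≤ potential H q b

theorem failProb_extendTree {n : ℕ} (hn : ∀ x, H x ≤ n) {q C b b' : ℝ} (hq : 1.6 ≤ √q)
    (hb : 0 ≤ b) (hC : C ≤ b') (N : ℕ) {T : ℕ} (hT : C * n ≤ 2 ^ T) (j : ℕ) (a : List ℝ × ℝ)
    (ha : IsGoodState H q C b b' j a) :
    (extendTree N T C a).failProb H (IsGoodState H q C b b' (j + 1)) ≤ T * (49 / 50) ^ N := by
  unfold extendTree
  split_ifs with h
  · rw [failProb_done]
    · positivity
    · exact ⟨ha.schedule, ha.slow, ha.length.trans (Nat.le_succ _), ha.ge, ha.le, Or.inl h⟩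
  · push Not at h
    have hf := failProb_bind H (f := fun y => done (a.1 ++ [y], y))
      (Q := IsGoodState H q C b b' (j + 1)) le_rfl
      (failProb_bisectTree H hn (hb.trans ha.ge) h N hT) (fun y hy => (failProb_done H ?_).le)
    · rwa [add_zero] at hf
    · obtain ⟨h1, h2, h3, h4⟩ := hy
      refine ⟨ha.schedule.concat h1, ha.slow.concat ha.schedule
        (ratio_le_of_le_overlap H h1.le (by norm_num) (by linarith)), ?_, ha.ge.trans h1.le,
        h2.trans hC, ?_⟩
      · simpa using ha.length
      · rcases h4 with h4 | h4
        · exact Or.inl h4.ge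
        · right
          have := potential_step H hq h1 h4
          rcases ha.progress with hp | hp
          · exact absurd hp (not_le.2 h)
          · dsimp only
            push_cast
            linarith

/-- `K` exceeds the range of the potential, so `K` good rounds must reach `C`. If `b'` is then still
ahead, the endpoint is at least `q` and one closing step is harmless, which accounts for the `+ 1`.
-/
theorem failProb_scheduleTree {n : ℕ} (hn : ∀ x, H x ≤ n) (hn1 : 1 ≤ n) (h0 : ∃ x, H x = 0)
    {q b b' : ℝ} (hq : q = Real.log (Fintype.card Ω)) (hq1 : 1.6 ≤ √q) (hb : 0 ≤ b) (hbb : b < b')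
    (N : ℕ) {T K : ℕ} (hT : q * n ≤ 2 ^ T) (hK : √q * (2.4 + Real.log n) < K) :
    (scheduleTree N T K (min q b') b b').failProb H (fun s => IsCoolingSchedule b b' s ∧
      IsSlowlyVarying H (2 * 10 ^ 5) s ∧ scheduleLength s ≤ K + 1) ≤
      K * (T * (49 / 50) ^ N) := by
  have hT' : min q b' * n ≤ 2 ^ T :=
    (mul_le_mul_of_nonneg_right (min_le_left _ _) (Nat.cast_nonneg n)).trans hT
  have hI : IsGoodState H q (min q b') b b' 0 ([b], b) :=
    ⟨⟨rfl, rfl, List.pairwise_singleton _ _⟩, List.isChain_singleton _, by simp, le_rfl, hbb.le,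
      Or.inr (by simp)⟩
  have hloop := failProb_repeatN H (by positivity)
    (failProb_extendTree H hn hq1 hb (min_le_right q b') N hT') K 0 _ hI
  have h := failProb_bind H (f := fun a : List ℝ × ℝ =>
      done (if b' ≤ a.2 then a.1 else a.1 ++ [b']))
    (Q := fun s => IsCoolingSchedule b b' s ∧ IsSlowlyVarying H (2 * 10 ^ 5) s ∧
      scheduleLength s ≤ K + 1) le_rfl hloop (fun a ha => (failProb_done H ?_).le)
  · rwa [add_zero] at h
  · rw [zero_add] at ha
    have hlen := ha.length
    split_ifs with hend
    · have he : a.2 = b' := le_antisymm ha.le hend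
      exact ⟨he ▸ ha.schedule, ha.slow, by unfold scheduleLength; omega⟩
    · push Not at hend
      refine ⟨ha.schedule.concat hend, ha.slow.concat ha.schedule ?_, ?_⟩
      · have hCa : min q b' ≤ a.2 := by
          rcases ha.progress with hp | hp
          · exact hp
          · exfalso
            have h1 := potential_le H hn hn1 hb
            have h2 := le_potential H h0 q a.2
            rw [← hq] at h1
            linarith
        have hqa : q ≤ a.2 := by
          rcases min_le_iff.1 hCa with h | h
          · exact h
          · linarith
        exact (ratio_le_two H h0 (hq ▸ hqa) hend.le).trans (by norm_num)
      · simp only [scheduleLength, List.length_append, List.length_singleton]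
        omega

/-! ## The procedure as a program -/

open SampleTree

namespace Program

/-- `(x, y) ↦ log 8` or `log (39 / 40)`, by comparing a sample at `x` with a sample at `y`. -/
def compare : Program (ℝ × ℝ) ℝ :=
  comp (ifLE (pair (comp fst sample) (comp snd sample)) (const 8) (const (39 / 40))) log

theorem run_compare (a : ℝ × ℝ) : compare.run a = compareTree a.1 a.2 := by
  simp only [compare, run, compareTree, done_bind, draw_bind]
  congr 1; funext u; congr 1; funext v
  split_ifs <;> simp [done_bind]

/-- The total outcome of `N` comparisons, from the input `(N, x, y)`. -/
def score : Program (ℝ × ℝ × ℝ) ℝ :=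
  comp (pair id (const 0)) (comp
    (loop (comp fst fst) (pair fst (comp (pair snd (comp (comp fst snd) compare)) add))) snd)

/-- A loop body sees only the loop state, so the program carries its inputs there; `repeatN_frame`
removes this constant component. -/
theorem run_score (a : ℝ × ℝ × ℝ) : score.run a = scoreTree ⌊a.1⌋₊ a.2.1 a.2.2 := by
  simp only [score, run, done_bind, run_compare, bind_assoc, Rat.cast_zero]
  rw [show (fun e : (ℝ × ℝ × ℝ) × ℝ => (compareTree e.1.2.1 e.1.2.2).bind fun c =>
      done (e.1, e.2 + c)) = fun e => ((fun (p : ℝ × ℝ × ℝ) (w : ℝ) =>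
        (compareTree p.2.1 p.2.2).bind fun c => done (w + c)) e.1 e.2).bind
          fun s => done (e.1, s) from ?_]
  · rw [repeatN_frame fun (p : ℝ × ℝ × ℝ) (w : ℝ) =>
      (compareTree p.2.1 p.2.2).bind fun c => done (w + c)]
    simp only [SampleTree.bind_assoc, done_bind, bind_done]
    rfl
  · funext e
    simp only [SampleTree.bind_assoc, done_bind]

/-- The parameters `(N, T, K, C)` of the procedure. -/
abbrev Params : Type := ℝ × ℝ × ℝ × ℝ

/-- The midpoint of the current interval of a bisection. -/
def midpoint {α : Type} : Program (α × ℝ × ℝ) ℝ :=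
  comp (pair (comp (pair (comp snd fst) (comp snd snd)) add) (const 2)) div

/-- The bisection, from the parameters and `x`. -/
def bisect : Program (Params × ℝ) ℝ :=
  comp (pair id (pair snd (comp fst (comp snd (comp snd snd)))))
    (comp (loop (comp fst (comp fst (comp snd fst)))
      (pair fst (ifLE
        (pair (const 0) (comp (pair (comp fst (comp fst fst)) (pair (comp fst snd) midpoint)) score))
        (pair midpoint (comp snd snd)) (pair (comp snd fst) midpoint))))
    (comp snd snd))

theorem run_bisect (a : Params × ℝ) :
    bisect.run a = bisectTree ⌊a.1.1⌋₊ ⌊a.1.2.1⌋₊ a.1.2.2.2 a.2 := by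
  simp only [bisect, midpoint, run, done_bind, run_score, bind_assoc, Rat.cast_zero,
    Rat.cast_ofNat]
  rw [show (fun e : (Params × ℝ) × ℝ × ℝ =>
      (scoreTree ⌊e.1.1.1⌋₊ e.1.2 ((e.2.1 + e.2.2) / 2)).bind fun w =>
        (if 0 ≤ w then done ((e.2.1 + e.2.2) / 2, e.2.2)
          else done (e.2.1, (e.2.1 + e.2.2) / 2)).bind fun s => done (e.1, s)) =
      fun e => (bisectStep ⌊e.1.1.1⌋₊ e.1.2 e.2).bind fun s => done (e.1, s) from ?_]
  · rw [repeatN_frame fun (p : Params × ℝ) s => bisectStep ⌊p.1.1⌋₊ p.2 s]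
    simp only [bind_assoc, done_bind]
    rfl
  · funext e
    simp only [bisectStep, bind_assoc]
    congr 1; funext w
    split_ifs <;> rfl

/-- Extend a schedule `s` that ends in `x`, given the parameters and `(s, x)`. -/
def extend : Program (Params × List ℝ × ℝ) (List ℝ × ℝ) :=
  ifLE (pair (comp fst (comp snd (comp snd snd))) (comp snd snd)) snd
    (comp (pair (comp snd fst) (comp (pair fst (comp snd snd)) bisect)) (pair push snd))

theorem run_extend (a : Params × List ℝ × ℝ) :
    extend.run a = extendTree ⌊a.1.1⌋₊ ⌊a.1.2.1⌋₊ a.1.2.2.2 a.2 := by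
  simp only [extend, run, done_bind, run_bisect, bind_assoc, extendTree]

/-- The schedule from `b` to `b'`, given the parameters and `(b, b')`. -/
def buildSchedule : Program (Params × ℝ × ℝ) (List ℝ) :=
  comp (pair (comp snd snd)
    (comp (comp (pair fst (pair (comp (pair nil (comp snd fst)) push) (comp snd fst)))
      (loop (comp fst (comp snd (comp snd fst))) (pair fst extend))) snd))
    (ifLE (pair fst (comp snd snd)) (comp snd fst) (comp (pair (comp snd fst) fst) push))

theorem run_buildSchedule (a : Params × ℝ × ℝ) : buildSchedule.run a =
    scheduleTree ⌊a.1.1⌋₊ ⌊a.1.2.1⌋₊ ⌊a.1.2.2.1⌋₊ a.1.2.2.2 a.2.1 a.2.2 := by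
  simp only [buildSchedule, run, done_bind, run_extend, bind_assoc]
  rw [repeatN_frame fun (p : Params) s => extendTree ⌊p.1⌋₊ ⌊p.2.1⌋₊ p.2.2.2 s]
  simp only [bind_assoc, done_bind, List.nil_append, scheduleTree]
  congr 1; funext s
  split_ifs <;> rfl

/-- `log q + log n` from the input `(n, |Ω|, …)`. -/
def logSize {α : Type} : Program (ℝ × ℝ × α) ℝ :=
  comp (pair (comp (comp snd fst) (comp log log)) (comp fst log)) add

/-- The parameters, from the input `(n, |Ω|, b, b', δ)`. -/
def params : Program (ℝ × ℝ × ℝ × ℝ × ℝ) Params :=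
  pair (comp (pair (comp (pair (const 1000) logSize) mul)
      (comp (comp (pair (const 1) (comp snd (comp snd (comp snd snd)))) div) log)) mul)
    (pair (comp (pair (comp (pair (const 2) logSize) mul) (const 1)) add)
      -- There is no square root instruction, so `√q` is computed as `exp (log q / 2)`.
      (pair (comp (pair (comp (pair (const 6) (comp (comp (pair
          (comp (comp snd fst) (comp log log)) (const 2)) div) exp)) mul) (comp fst log)) mul)
        (ifLE (pair (comp (comp snd fst) log) (comp snd (comp snd (comp snd fst))))
          (comp (comp snd fst) log) (comp snd (comp snd (comp snd fst))))))

/-- The procedure that builds a cooling schedule. -/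
def coolingProcedure : Program (ℝ × ℝ × ℝ × ℝ × ℝ) (List ℝ) :=
  comp (pair params (pair (comp snd (comp snd fst)) (comp snd (comp snd (comp snd fst)))))
    buildSchedule

theorem run_coolingProcedure (n W b b' δ : ℝ) : coolingProcedure.run (n, W, b, b', δ) =
    scheduleTree ⌊1000 * (Real.log (Real.log W) + Real.log n) * Real.log (1 / δ)⌋₊
      ⌊2 * (Real.log (Real.log W) + Real.log n) + 1⌋₊
      ⌊6 * Real.exp (Real.log (Real.log W) / 2) * Real.log n⌋₊ (min (Real.log W) b') b b' := by
  have h : (if Real.log W ≤ b' then done (Real.log W) else done b') =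
      done (min (Real.log W) b') := by
    rw [min_def]; split_ifs <;> rfl
  simp only [coolingProcedure, params, logSize, run, done_bind, run_buildSchedule,
    Rat.cast_ofNat, Rat.cast_one, h]

end Program

/-! ### Choice of parameters and conclusion. -/

/-- The union bound over all comparisons. -/
theorem mul_pow_le_exp_neg {S L lam : ℝ} {K T N : ℕ} (hL2 : 2 ≤ L) (hlam : 0.69 ≤ lam)
    (hS0 : 0 ≤ S) (hS : S ≤ Real.exp L) (hK : (K : ℝ) ≤ 6 * S) (hT : (T : ℝ) ≤ 2.5 * L)
    (hN : 1000 * (L * lam) - 1 ≤ N) : (K : ℝ) * (T * (49 / 50) ^ N) ≤ Real.exp (-lam) := by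
  have h1 : 0.69 * L ≤ L * lam := by nlinarith only [hL2, hlam]
  have h2 : 2 * lam ≤ L * lam := by nlinarith only [hL2, hlam]
  -- `N/50 ≥ 20 L lam - 1/50`; the rounding loss is absorbed by passing from `20` to `19`.
  have hpow : ((49 : ℝ) / 50) ^ N ≤ Real.exp (-(19 * (L * lam))) := by
    have h : (49 : ℝ) / 50 ≤ Real.exp (-(1 / 50)) := by
      linarith [Real.add_one_le_exp (-(1 / 50) : ℝ)]
    refine (pow_le_pow_left₀ (by norm_num) h N).trans ?_
    rw [← Real.exp_nat_mul]
    exact Real.exp_le_exp.2 (by linarith)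
  have hLle : L ≤ Real.exp L := by linarith [Real.add_one_le_exp L]
  have h15 : (15 : ℝ) ≤ Real.exp (2 * L) := by
    refine le_trans ?_ (Real.exp_le_exp.2 (by linarith : (4 : ℝ) ≤ 2 * L))
    have h : Real.exp 4 = Real.exp 1 ^ 4 := by rw [← Real.exp_nat_mul]; norm_num
    rw [h]
    calc (15 : ℝ) ≤ 2.7 ^ 4 := by norm_num
      _ ≤ _ := pow_le_pow_left₀ (by norm_num) (by linarith [Real.exp_one_gt_d9]) 4
  have hKT : (K : ℝ) * T ≤ Real.exp (4 * L) := by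
    calc (K : ℝ) * T ≤ (6 * S) * (2.5 * L) := mul_le_mul hK hT (Nat.cast_nonneg T) (by linarith)
      _ = 15 * (S * L) := by ring
      _ ≤ Real.exp (2 * L) * (Real.exp L * Real.exp L) :=
        mul_le_mul h15 (mul_le_mul hS hLle (by linarith) (Real.exp_pos _).le)
          (mul_nonneg hS0 (by linarith)) (Real.exp_pos _).le
      _ = Real.exp (4 * L) := by rw [← Real.exp_add, ← Real.exp_add]; congr 1; ring
  calc (K : ℝ) * (T * (49 / 50) ^ N) = K * T * (49 / 50) ^ N := by ring
    _ ≤ Real.exp (4 * L) * Real.exp (-(19 * (L * lam))) :=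
      mul_le_mul hKT hpow (by positivity) (Real.exp_pos _).le
    _ = Real.exp (4 * L - 19 * (L * lam)) := by rw [← Real.exp_add]; congr 1
    _ ≤ Real.exp (-lam) := Real.exp_le_exp.2 (by linarith)

end Gibbs
end

theorem theorem2p9 :
    ∃ procedure : Gibbs.Program (ℝ × ℝ × ℝ × ℝ × ℝ) (List ℝ),
      ∀ (Ω : Type*) [Fintype Ω] [Nonempty Ω] (n : ℕ) (H : Ω → ℕ) (q βmin βmax δ : ℝ),
        (∀ x, H x ≤ n) → (∃ x, H x = 0) →
        q = Real.log (Fintype.card Ω) →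
        1 ≤ Real.log n → 1 ≤ Real.log q → Real.log n ≤ Fintype.card Ω →
        0 ≤ βmin → βmin < βmax → 0 < δ → δ ≤ 1 / 2 →
        let computation := procedure.run ((n : ℝ), (Fintype.card Ω : ℝ), βmin, βmax, δ)
        ENNReal.ofReal (1 - δ) ≤ (computation.outputLaw H).toOuterMeasure
            {s | Gibbs.IsCoolingSchedule βmin βmax s ∧
              Gibbs.IsSlowlyVarying H (2 * 10 ^ 5) s ∧
              (Gibbs.scheduleLength s : ℝ) ≤ 11 * √q * Real.log n} ∧
          (computation.numSamples H : ℝ) ≤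
            5 * 10 ^ 4 * q * Real.log n ^ 2 * (Real.log q + Real.log n) ^ 2 * Real.log (1 / δ) := by
  refine ⟨Gibbs.Program.coolingProcedure, ?_⟩
  intro Ω _ _ n H q b b' δ hn h0 hq hlogn hlogq _ hb hbb hδ hδ2
  dsimp only
  rw [Gibbs.Program.run_coolingProcedure, ← hq]
  set l := Real.log n with hl
  set L := Real.log q + l with hL
  set lam := Real.log (1 / δ) with hlam
  -- `Real.log 0 = 0`, so the bound on `log n` excludes `n = 0`; the same convention excludes `q =
  -- 0` below.
  have hn0 : n ≠ 0 := by rintro rfl; simp [hl] at hlogn; linarith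
  have hnpos : (0 : ℝ) < n := by exact_mod_cast Nat.pos_of_ne_zero hn0
  have hq0 : 0 ≤ q := by
    rw [hq]; exact Real.log_nonneg (by exact_mod_cast Fintype.card_pos)
  have hqpos : 0 < q := by
    rcases hq0.eq_or_lt with h | h
    · rw [← h, Real.log_zero] at hlogq; linarith
    · exact h
  have hqe : Real.exp 1 ≤ q := (Real.le_log_iff_exp_le hqpos).1 hlogq
  have hs : 1.6 ≤ √q := Real.le_sqrt_of_sq_le (by linarith [Real.exp_one_gt_d9])
  have hexp : Real.exp (Real.log q / 2) = √q := by
    rw [← Real.log_sqrt hq0, Real.exp_log (by linarith)]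
  rw [hexp]
  set S := √q * l with hS
  have hS1 : 1.6 ≤ S := by nlinarith
  have hSsq : S ^ 2 = q * l ^ 2 := by rw [hS, mul_pow, Real.sq_sqrt hq0]
  have hL2 : 2 ≤ L := by linarith
  have hlam1 : 0.69 ≤ lam := by
    have h2 : Real.log 2 ≤ lam :=
      Real.log_le_log (by norm_num) ((le_div_iff₀ hδ).2 (by linarith))
    linarith [Real.log_two_gt_d9]
  have hLlam : 0 ≤ L * lam := by positivity
  set N := ⌊1000 * L * lam⌋₊ with hN
  set T := ⌊2 * L + 1⌋₊ with hT
  set K := ⌊6 * √q * l⌋₊ with hK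
  have hN1 : (N : ℝ) ≤ 1000 * (L * lam) := by
    rw [← mul_assoc]; exact Nat.floor_le (by nlinarith)
  have hN2 : 1000 * (L * lam) - 1 ≤ N := by
    rw [← mul_assoc]; exact (Nat.sub_one_lt_floor _).le
  have hT1 : (T : ℝ) ≤ 2.5 * L := (Nat.floor_le (by linarith)).trans (by linarith)
  have hT2 : 2 * L ≤ T := by
    have := Nat.sub_one_lt_floor (2 * L + 1)
    linarith
  have hK1 : (K : ℝ) ≤ 6 * S := by
    rw [hS, ← mul_assoc]; exact Nat.floor_le (by nlinarith)
  have hK2 : 6 * S - 1 ≤ K := by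
    rw [hS, ← mul_assoc]; exact (Nat.sub_one_lt_floor _).le
  have hK0 : (0 : ℝ) ≤ K := Nat.cast_nonneg K
  have hexpL : Real.exp L = q * n := by
    rw [hL, hl, Real.exp_add, Real.exp_log hqpos, Real.exp_log hnpos]
  constructor
  · refine Gibbs.SampleTree.le_toOuterMeasure_outputLaw H (P := fun s =>
      Gibbs.IsCoolingSchedule b b' s ∧ Gibbs.IsSlowlyVarying H (2 * 10 ^ 5) s ∧
        (Gibbs.scheduleLength s : ℝ) ≤ 11 * √q * l) ?_
    -- `T ≥ 2L` suffices because `2 log 2 ≥ 1` and `exp L = q n`.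
    have hTpow : q * n ≤ 2 ^ T := by
      rw [← hexpL, ← Real.rpow_natCast, Real.rpow_def_of_pos (by norm_num)]
      exact Real.exp_le_exp.2 (by nlinarith [Real.log_two_gt_d9])
    -- As `l ≥ 1`, the left side is at most `3.4 S`, and `6 S - 1` exceeds this because `S ≥ 1.6`.
    have hKbig : √q * (2.4 + l) < K := by nlinarith
    refine (Gibbs.SampleTree.failProb_mono H (P := fun s => Gibbs.IsCoolingSchedule b b' s ∧
      Gibbs.IsSlowlyVarying H (2 * 10 ^ 5) s ∧ Gibbs.scheduleLength s ≤ K + 1)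
      (fun _ h => ⟨h.1, h.2.1, ?_⟩) _).trans
      ((Gibbs.failProb_scheduleTree H hn (Nat.pos_of_ne_zero hn0) h0 hq hs hb hbb N hTpow
        hKbig).trans ?_)
    · have hSle : S ≤ Real.exp L := by
        have h1 : l ≤ n := (Real.log_le_sub_one_of_pos hnpos).trans (by linarith)
        have h2 : √q ≤ q := by nlinarith only [Real.sq_sqrt hq0, hs]
        rw [hexpL, hS]
        exact mul_le_mul h2 h1 (by linarith) hq0
      refine (Gibbs.mul_pow_le_exp_neg hL2 hlam1 (by linarith) hSle hK1 hT1 hN2).trans ?_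
      rw [hlam, one_div, Real.log_inv, neg_neg, Real.exp_log hδ]
    · have h1 := (Nat.cast_le (α := ℝ)).2 h.2.2
      push_cast at h1
      rw [mul_assoc, ← hS]
      linarith
  · have h1 : (((Gibbs.scheduleTree N T K (min q b') b b').numSamples H : ℕ) : ℝ) ≤
        K * (T * (N * 2)) := by
      exact_mod_cast Gibbs.numSamples_scheduleTree_le H N T K (min q b') b b'
    refine h1.trans ?_
    calc (K : ℝ) * (T * (N * 2)) ≤ (6 * S) * ((2.5 * L) * (1000 * (L * lam) * 2)) := by gcongr
      _ = 30000 * S * (L ^ 2 * lam) := by ring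
      -- The cost is linear in `S = √q ln n`; the claimed bound is quadratic and follows from `S ≥
      -- 1.6`.
      _ ≤ 5 * 10 ^ 4 * S ^ 2 * (L ^ 2 * lam) := by
          refine mul_le_mul_of_nonneg_right ?_ (by positivity)
          nlinarith only [hS1]
      _ = _ := by rw [hSsq]; ring
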